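/- Let $X$ be a complex Banach space and let $L(X)$ be the algebra of bounded linear operators on $X$. For a linear operator $S$ from a vector space to itself let $\alpha(S)\in\{0,1,\dots,\infty\}$ be the dimension of its kernel and $\beta(S)\in\{0,1,\dots,\infty\}$ the codimension of its range. For $T\in L(X)$ and $k\in\mathbb N=\{0,1,2,\dots\}$ let $\mathcal R(T^k)$ be the range of $T^k$ and let $T_{[k]}:\mathcal R(T^k)\to\mathcal R(T^k)$ be the restriction of $T$. With $\inf\emptyset=\infty$, put $$a_e(T)=\inf\{k\in\mathbb N:\alpha(T_{[k]})<\infty\},\qquad d_e(T)=\inf\{k\in\mathbb N:\beta(T_{[k]})<\infty\},$$ $$m_T=\inf\{k\in\mathbb N:\min\{\alpha(T_{[k]}),\beta(T_{[k]})\}<\infty\}.$$ The operator $T$ is called upper semi-B-Fredholm if $a_e(T)<\infty$ and $\mathcal R(T^{a_e(T)+1})$ is closed, lower semi-B-Fredholm if $d_e(T)<\infty$ and $\mathcal R(T^{d_e(T)})$ is closed, and semi-B-Fredholm if it is upper or lower semi-B-Fredholm. If $T$ is semi-B-Fredholm (so that $m_T<\infty$), its index is $\mathrm{ind}(T)=\alpha(T_{[m_T]})-\beta(T_{[m_T]})\in\mathbb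 Z\cup\{-\infty,\infty\}$. Proposition. Let $T\in L(X)$ and let $n$ be a strictly positive integer. Then $T$ is semi-B-Fredholm if and only if $T^n$ is semi-B-Fredholm. If this is the case, then $\mathrm{ind}(T^n)=n\cdot\mathrm{ind}(T)$. -/

import Mathlib

namespace SemiBFredholm

open scoped ENNReal

/-- `α(S)`: the dimension of the kernel of `S`, in `{0, 1, 2, …, ∞}`. -/
noncomputable def alpha {E : Type*} [AddCommGroup E] [Module ℂ E] (S : E →ₗ[ℂ] E) : ℕ∞ :=
  Cardinal.toENat (Module.rank ℂ (LinearMap.ker S))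

/-- `β(S)`: the codimension of the range of `S`, in `{0, 1, 2, …, ∞}`. -/
noncomputable def beta {E : Type*} [AddCommGroup E] [Module ℂ E] (S : E →ₗ[ℂ] E) : ℕ∞ :=
  Cardinal.toENat (Module.rank ℂ (E ⧸ LinearMap.range S))

section Operator

variable {X : Type*} [NormedAddCommGroup X] [NormedSpace ℂ X]

/-- `R(T ^ n)`, the range of the `n`-th iterate of `T`. -/
def rangePow (T : X →L[ℂ] X) (n : ℕ) : Submodule ℂ X :=
  LinearMap.range ((T ^ n : X →L[ℂ] X) : X →ₗ[ℂ] X)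

/-- `R(T ^ n)` is invariant under `T`. -/
theorem apply_mem_rangePow (T : X →L[ℂ] X) (n : ℕ) :
    ∀ x ∈ rangePow T n, (T : X →ₗ[ℂ] X) x ∈ rangePow T n := by
  rintro x ⟨y, rfl⟩
  refine ⟨T y, ?_⟩
  change (T ^ n * T) y = (T * T ^ n) y
  rw [← pow_succ, ← pow_succ']

/-- `T_[n]`: the restriction of `T` to `R(T ^ n)`, as an operator from `R(T ^ n)` to itself. -/
def restr (T : X →L[ℂ] X) (n : ℕ) : rangePow T n →ₗ[ℂ] rangePow T n :=
  (T : X →ₗ[ℂ] X).restrict (apply_mem_rangePow T n)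

/-- The essential ascent `a_e(T) = inf {n : α(T_[n]) < ∞}`, with `inf ∅ = ∞`. -/
noncomputable def essAscent (T : X →L[ℂ] X) : ℕ∞ :=
  sInf {k : ℕ∞ | ∃ n : ℕ, k = n ∧ alpha (restr T n) < ⊤}

/-- The essential descent `d_e(T) = inf {n : β(T_[n]) < ∞}`, with `inf ∅ = ∞`. -/
noncomputable def essDescent (T : X →L[ℂ] X) : ℕ∞ :=
  sInf {k : ℕ∞ | ∃ n : ℕ, k = n ∧ beta (restr T n) < ⊤}

/-- The essential degree `m_T = inf {n : min (α(T_[n])) (β(T_[n])) < ∞}`, with `inf ∅ = ∞`. -/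
noncomputable def essDegree (T : X →L[ℂ] X) : ℕ∞ :=
  sInf {k : ℕ∞ | ∃ n : ℕ, k = n ∧ min (alpha (restr T n)) (beta (restr T n)) < ⊤}

/-- `T` is upper semi-B-Fredholm: `a_e(T) < ∞` and `R(T ^ (a_e(T) + 1))` is closed. -/
def IsUpperSemiBFredholm (T : X →L[ℂ] X) : Prop :=
  ∃ a : ℕ, essAscent T = a ∧ IsClosed (rangePow T (a + 1) : Set X)

/-- `T` is lower semi-B-Fredholm: `d_e(T) < ∞` and `R(T ^ d_e(T))` is closed. -/
def IsLowerSemiBFredholm (T : X →L[ℂ] X) : Prop :=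
  ∃ d : ℕ, essDescent T = d ∧ IsClosed (rangePow T d : Set X)

/-- `T` is semi-B-Fredholm: it is upper semi-B-Fredholm or lower semi-B-Fredholm. -/
def IsSemiBFredholm (T : X →L[ℂ] X) : Prop :=
  IsUpperSemiBFredholm T ∨ IsLowerSemiBFredholm T

/-- The index `α(T_[m]) - β(T_[m])`, `m = m_T`, of a semi-B-Fredholm operator, an element of
`ℤ ∪ {-∞, ∞}`. It is meaningful when `m_T < ∞`, which holds for semi-B-Fredholm operators;
one of the two terms is then finite. -/
noncomputable def index (T : X →L[ℂ] X) : EReal :=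
  ((alpha (restr T (essDegree T).toNat) : ℝ≥0∞) : EReal) -
    ((beta (restr T (essDegree T).toNat) : ℝ≥0∞) : EReal)

/-- For a semi-B-Fredholm operator the essential degree is finite and attained, so the difference
that defines the index is never `∞ - ∞`. -/
theorem IsSemiBFredholm.index_wellDefined {T : X →L[ℂ] X} (hT : IsSemiBFredholm T) :
    essDegree T < ⊤ ∧
      min (alpha (restr T (essDegree T).toNat)) (beta (restr T (essDegree T).toNat)) < ⊤ := by
  have key : ∀ P : ℕ → Prop, ∀ a : ℕ, sInf {k : ℕ∞ | ∃ n : ℕ, k = n ∧ P n} = a →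
      P a := by
    intro P a h
    have hne : {k : ℕ∞ | ∃ n : ℕ, k = n ∧ P n}.Nonempty := by
      by_contra hc
      rw [Set.not_nonempty_iff_eq_empty] at hc
      rw [hc, sInf_empty] at h
      exact ENat.top_ne_natCast a h
    obtain ⟨n, hn, hP⟩ := csInf_mem hne
    rw [h] at hn
    rwa [Nat.cast_inj.mp hn]
  have hne : ∃ n : ℕ, min (alpha (restr T n)) (beta (restr T n)) < ⊤ := by
    rcases hT with ⟨a, ha, -⟩ | ⟨d, hd, -⟩
    · exact ⟨a, min_lt_of_left_lt (key _ a ha)⟩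
    · exact ⟨d, min_lt_of_right_lt (key _ d hd)⟩
  obtain ⟨n, hn⟩ := hne
  have hlt : essDegree T < ⊤ := lt_of_le_of_lt (sInf_le ⟨n, rfl, hn⟩) (ENat.natCast_lt_top n)
  exact ⟨hlt, key (fun n => min (alpha (restr T n)) (beta (restr T n)) < ⊤) _
    (ENat.natCast_toNat hlt.ne).symm⟩

end Operator

end SemiBFredholm

/-! Write `α_k = dim (R(T^k) ∩ ker T)` and `β_k = dim R(T^k)/R(T^(k+1))` for the nullity and defect
of `T_[k]`. Filtering by the intermediate powers of `T` shows that `(T^n)_[k]` has nullity `∑_{j<n}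
α_(nk+j)` and defect `∑_{j<n} β_(nk+j)` (`alpha_restr_pow`, `beta_restr_pow`).

From `k` to `k+1`, `α` and `β` drop by the same amount (`nul_eq_drop_add`, `defect_eq_drop_add`). So
both sequences decrease, and such a sum is finite iff its first term is. Moreover `α_k - β_k` is
constant from `m_T` on, so the index of `T^n` is a sum of `n` copies of that of `T`.

The closedness conditions do not depend on using the least exponent: when `α_k` or `β_k` is finite,
closedness passes between ranges, by Neubauer's lemma and the open mapping theorem
(`isUpperSemiBFredholm_iff`, `isLowerSemiBFredholm_iff`). Both conditions can then be compared at
exponents `k` and `nk`. -/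

namespace SemiBFredholm

open scoped ENNReal

/-! ### Algebra of dimensions and codimensions along the iterated ranges. -/

section Rank

universe u
variable {V W : Type u} [AddCommGroup V] [Module ℂ V] [AddCommGroup W] [Module ℂ W]

/-- The dimension of a subspace, in `{0, 1, 2, …, ∞}`. -/
noncomputable def edim (P : Submodule ℂ V) : ℕ∞ :=
  Cardinal.toENat (Module.rank ℂ P)

theorem edim_lt_top_iff {P : Submodule ℂ V} : edim P < ⊤ ↔ FiniteDimensional ℂ P := by
  rw [edim, Cardinal.toENat_lt_top, Module.rank_lt_aleph0_iff]

theorem edim_mono {P Q : Submodule ℂ V} (h : P ≤ Q) : edim P ≤ edim Q :=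
  OrderHomClass.mono Cardinal.toENat (Submodule.rank_mono h)

theorem edim_map_of_injective (f : V →ₗ[ℂ] W) (hf : Function.Injective f) (P : Submodule ℂ V) :
    edim (P.map f) = edim P := by
  rw [edim, edim, (Submodule.equivMapOfInjective f hf P).rank_eq]

/-- The rank-nullity formula for the restriction of a linear map to a subspace. -/
theorem edim_eq_map_add (f : V →ₗ[ℂ] W) (P : Submodule ℂ V) :
    edim P = edim (P.map f) + edim (P ⊓ LinearMap.ker f) := by
  have h := LinearMap.rank_range_add_rank_ker (f.domRestrict P)
  have hk : edim (P ⊓ LinearMap.ker f) = edim (LinearMap.ker (f.domRestrict P)) := by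
    rw [← edim_map_of_injective P.subtype P.injective_subtype]
    congr 1
    ext x
    simp [LinearMap.mem_ker, and_comm]
  rw [LinearMap.range_domRestrict] at h
  rw [hk]
  simp only [edim, ← h, map_add]

/-- The codimension of `B` in `A`, for `B ≤ A`. -/
noncomputable def ecodim (B A : Submodule ℂ V) : ℕ∞ :=
  edim (A.map B.mkQ)

theorem ecodim_add {A B C : Submodule ℂ V} (hBA : B ≤ A) (hCB : C ≤ B) :
    ecodim C A = ecodim B A + ecodim C B := by
  have h := edim_eq_map_add (Submodule.factor hCB) (A.map C.mkQ)
  have h1 : (A.map C.mkQ).map (Submodule.factor hCB) = A.map B.mkQ := by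
    rw [← Submodule.map_comp]; rfl
  have h2 : A.map C.mkQ ⊓ LinearMap.ker (Submodule.factor hCB) = B.map C.mkQ := by
    ext x
    obtain ⟨v, rfl⟩ := C.mkQ_surjective x
    constructor
    · rintro ⟨-, hv⟩
      exact ⟨v, by simpa [LinearMap.mem_ker, Submodule.factor] using hv, rfl⟩
    · rintro ⟨b, hb, hbv⟩
      rw [← hbv]
      exact ⟨⟨b, hBA hb, rfl⟩, by simpa [LinearMap.mem_ker, Submodule.factor] using hb⟩
  rwa [h1, h2] at h

theorem edim_eq_ecodim_add (P C : Submodule ℂ V) : edim P = ecodim C P + edim (P ⊓ C) := by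
  simpa [ecodim] using edim_eq_map_add C.mkQ P

theorem beta_eq_ecodim {A : Submodule ℂ V} (S : A →ₗ[ℂ] A) :
    beta S = ecodim ((LinearMap.range S).map A.subtype) A := by
  have h : LinearMap.range S = LinearMap.ker
      (((LinearMap.range S).map A.subtype).mkQ ∘ₗ A.subtype) := by
    rw [LinearMap.ker_comp, Submodule.ker_mkQ,
      Submodule.comap_map_eq_of_injective A.injective_subtype]
  have e := (Submodule.quotEquivOfEq _ _ h).trans
    (((LinearMap.range S).map A.subtype).mkQ ∘ₗ A.subtype).quotKerEquivRange
  rw [beta, e.rank_eq, ecodim, edim, LinearMap.range_comp, Submodule.range_subtype]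

/-- The range of `f` to the `k`-th power. -/
def iterRange (f : V →ₗ[ℂ] V) (k : ℕ) : Submodule ℂ V := LinearMap.range (f ^ k)

theorem iterRange_map (f : V →ₗ[ℂ] V) (j k : ℕ) :
    (iterRange f k).map (f ^ j) = iterRange f (k + j) := by
  rw [iterRange, ← LinearMap.range_comp, iterRange, add_comm, pow_add]; rfl

theorem iterRange_map_succ (f : V →ₗ[ℂ] V) (k : ℕ) :
    (iterRange f k).map f = iterRange f (k + 1) := by
  simpa using iterRange_map f 1 k

theorem iterRange_antitone (f : V →ₗ[ℂ] V) : Antitone (iterRange f) := by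
  intro j k h
  obtain ⟨i, rfl⟩ := Nat.exists_eq_add_of_le h
  rw [iterRange, pow_add]
  exact LinearMap.range_comp_le_range _ _

/-- The dimension of the kernel of `f` inside the range of `f ^ k`. -/
noncomputable def nul (f : V →ₗ[ℂ] V) (k : ℕ) : ℕ∞ := edim (iterRange f k ⊓ LinearMap.ker f)

/-- The codimension of the range of `f ^ (k + 1)` in the range of `f ^ k`. -/
noncomputable def defect (f : V →ₗ[ℂ] V) (k : ℕ) : ℕ∞ :=
  ecodim (iterRange f (k + 1)) (iterRange f k)

/-- In the inductive step, `f ^ n` maps `R(f^k) ∩ ker f^(n+1)` onto `R(f^(k+n)) ∩ ker f`, with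
kernel `R(f^k) ∩ ker f^n`. -/
theorem edim_iterRange_inf_ker_pow (f : V →ₗ[ℂ] V) (k n : ℕ) :
    edim (iterRange f k ⊓ LinearMap.ker (f ^ n)) = ∑ j ∈ Finset.range n, nul f (k + j) := by
  induction n with
  | zero =>
    have : LinearMap.ker (f ^ 0) = ⊥ := by rw [pow_zero]; exact LinearMap.ker_id
    rw [this]
    simp [edim]
  | succ n ih =>
    have hle : LinearMap.ker (f ^ n) ≤ LinearMap.ker (f ^ (n + 1)) := by
      intro x hx
      rw [LinearMap.mem_ker] at hx ⊢
      rw [pow_succ', Module.End.mul_apply, hx, map_zero]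
    rw [edim_eq_map_add (f ^ n), Finset.sum_range_succ, ← ih, add_comm]
    congr 1
    · rw [inf_assoc, inf_eq_right.2 hle]
    · rw [nul, ← iterRange_map]
      congr 1
      ext x
      constructor
      · rintro ⟨y, ⟨hy, hy'⟩, rfl⟩
        refine ⟨⟨y, hy, rfl⟩, ?_⟩
        simpa [pow_succ'] using hy'
      · rintro ⟨⟨y, hy, rfl⟩, hy'⟩
        exact ⟨y, ⟨hy, by simpa [pow_succ'] using hy'⟩, rfl⟩

theorem ecodim_iterRange (f : V →ₗ[ℂ] V) (k n : ℕ) :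
    ecodim (iterRange f (k + n)) (iterRange f k) = ∑ j ∈ Finset.range n, defect f (k + j) := by
  induction n with
  | zero =>
    have : (iterRange f k).map (iterRange f k).mkQ = ⊥ := by simp
    simp [ecodim, this, edim]
  | succ n ih =>
    rw [Finset.sum_range_succ, ← ih]
    exact ecodim_add (iterRange_antitone f (by lia)) (iterRange_antitone f (by lia))

/-- The common drop of `nul f` and `defect f` from `k` to `k + 1`. -/
noncomputable def drop (f : V →ₗ[ℂ] V) (k : ℕ) : ℕ∞ :=
  ecodim (iterRange f (k + 1)) (iterRange f k ⊓ LinearMap.ker f)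

/-- Rank-nullity for the quotient map by `R(f^(k+1))`. Here `ecodim` is used without an inclusion,
as the dimension of an image in the quotient. -/
theorem nul_eq_drop_add (f : V →ₗ[ℂ] V) (k : ℕ) : nul f k = drop f k + nul f (k + 1) := by
  rw [nul, edim_eq_ecodim_add _ (iterRange f (k + 1)), drop, nul]
  congr 2
  rw [inf_right_comm, inf_eq_right.2 (iterRange_antitone f (Nat.le_succ k))]

/-- `f` induces a surjection `R(f^k)/R(f^(k+1)) → R(f^(k+1))/R(f^(k+2))` whose kernel is the image
of `R(f^k) ∩ ker f`. -/
theorem defect_eq_drop_add (f : V →ₗ[ℂ] V) (k : ℕ) :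
    defect f k = drop f k + defect f (k + 1) := by
  have hle : iterRange f (k + 1) ≤ (iterRange f (k + 1 + 1)).comap f := by
    rw [← Submodule.map_le_iff_le_comap, iterRange_map_succ]
  have h := edim_eq_map_add (Submodule.mapQ _ _ f hle)
    ((iterRange f k).map (iterRange f (k + 1)).mkQ)
  have h1 : ((iterRange f k).map (iterRange f (k + 1)).mkQ).map (Submodule.mapQ _ _ f hle) =
      (iterRange f (k + 1)).map (iterRange f (k + 1 + 1)).mkQ := by
    rw [← Submodule.map_comp, Submodule.mapQ, Submodule.liftQ_mkQ, Submodule.map_comp,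
      iterRange_map_succ]
  have h2 : (iterRange f k).map (iterRange f (k + 1)).mkQ ⊓
      LinearMap.ker (Submodule.mapQ _ _ f hle) =
      (iterRange f k ⊓ LinearMap.ker f).map (iterRange f (k + 1)).mkQ := by
    ext x
    constructor
    · rintro ⟨⟨v, hv, rfl⟩, hv'⟩
      have hfv : f v ∈ iterRange f (k + 1 + 1) := by
        simpa [LinearMap.mem_ker] using hv'
      rw [← iterRange_map_succ] at hfv
      obtain ⟨y, hy, hyv⟩ := hfv
      -- Since `f v = f y` with `y ∈ R(f^(k+1))`, the vector `v - y` lies in `ker f` and represents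
      -- the class of `v`.
      refine ⟨v - y, ⟨sub_mem hv (iterRange_antitone f (Nat.le_succ k) hy), ?_⟩, ?_⟩
      · simp [LinearMap.mem_ker, hyv]
      · simpa [sub_eq_self] using hy
    · rintro ⟨v, ⟨hv, hv'⟩, rfl⟩
      refine ⟨⟨v, hv, rfl⟩, ?_⟩
      have hv0 : f v = 0 := hv'
      simp [hv0]
  rw [h1, h2] at h
  exact h.trans (add_comm _ _)

theorem nul_antitone (f : V →ₗ[ℂ] V) : Antitone (nul f) :=
  fun _ _ h => edim_mono (inf_le_inf_right _ (iterRange_antitone f h))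

theorem defect_antitone (f : V →ₗ[ℂ] V) : Antitone (defect f) :=
  antitone_nat_of_succ_le fun k => by rw [defect_eq_drop_add f k]; exact le_add_self

/-- The invariance of `nul - defect`, in additive form because either term may be infinite. -/
theorem exists_nul_defect_eq_add (f : V →ₗ[ℂ] V) (m i : ℕ) :
    ∃ c : ℕ∞, nul f m = c + nul f (m + i) ∧ defect f m = c + defect f (m + i) := by
  induction i with
  | zero => exact ⟨0, by simp⟩
  | succ i ih =>
    obtain ⟨c, h1, h2⟩ := ih
    refine ⟨c + drop f (m + i), ?_, ?_⟩
    · rw [h1, nul_eq_drop_add f (m + i), add_assoc, add_assoc]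
    · rw [h2, defect_eq_drop_add f (m + i), add_assoc, add_assoc]

end Rank

/-! ### Closedness of operator ranges. -/

section ClosedRange

variable {Y Z : Type*} [NormedAddCommGroup Y] [NormedSpace ℂ Y] [CompleteSpace Y]
  [NormedAddCommGroup Z] [NormedSpace ℂ Z] [CompleteSpace Z]

/-- A subspace of a closed range is closed as soon as its preimage is. -/
theorem isClosed_of_isClosed_preimage (S : Y →L[ℂ] Z)
    (hS : IsClosed (LinearMap.range (S : Y →ₗ[ℂ] Z) : Set Z)) (M : Submodule ℂ Z)
    (hM : M ≤ LinearMap.range (S : Y →ₗ[ℂ] Z))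
    (h : IsClosed (M.comap (S : Y →ₗ[ℂ] Z) : Set Y)) : IsClosed (M : Set Z) := by
  have : CompleteSpace (LinearMap.range (S : Y →ₗ[ℂ] Z)) := hS.completeSpace_coe
  let g : Y →L[ℂ] LinearMap.range (S : Y →ₗ[ℂ] Z) := S.codRestrict _ fun y => ⟨y, rfl⟩
  have hg : Function.Surjective g := by
    rintro ⟨_, y, rfl⟩
    exact ⟨y, rfl⟩
  -- By the open mapping theorem the surjection `g` is a quotient map, so closedness can be tested
  -- on preimages.
  have h1 : IsClosed (((↑) : LinearMap.range (S : Y →ₗ[ℂ] Z) → Z) ⁻¹' (M : Set Z)) :=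
    (g.isQuotientMap hg).isClosed_preimage.1 h
  have h2 := hS.isClosedEmbedding_subtypeVal.isClosedMap _ h1
  convert h2 using 1
  exact (Set.image_preimage_eq_of_subset fun x hx => ⟨⟨x, hM hx⟩, rfl⟩).symm

/-- Neubauer's lemma: an operator range is closed if its sum and its intersection with some closed
subspace are closed. -/
theorem isClosed_range_of_isClosed_sup_inf (S : Y →L[ℂ] Z) (N : Submodule ℂ Z)
    (hN : IsClosed (N : Set Z))
    (hsup : IsClosed ((LinearMap.range (S : Y →ₗ[ℂ] Z) ⊔ N : Submodule ℂ Z) : Set Z))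
    (hinf : IsClosed ((LinearMap.range (S : Y →ₗ[ℂ] Z) ⊓ N : Submodule ℂ Z) : Set Z)) :
    IsClosed (LinearMap.range (S : Y →ₗ[ℂ] Z) : Set Z) := by
  have : CompleteSpace N := hN.completeSpace_coe
  have hr : LinearMap.range ((S.coprod N.subtypeL : Y × N →L[ℂ] Z) : Y × N →ₗ[ℂ] Z) =
      LinearMap.range (S : Y →ₗ[ℂ] Z) ⊔ N := by
    rw [ContinuousLinearMap.range_coprod]
    simp
  refine isClosed_of_isClosed_preimage (S.coprod N.subtypeL) (by rwa [hr])
    _ (by rw [hr]; exact le_sup_left) ?_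
  -- `S y + z` lies in the range of `S` iff `z` does, so the preimage only constrains the second
  -- coordinate.
  have : ((LinearMap.range (S : Y →ₗ[ℂ] Z)).comap
      ((S.coprod N.subtypeL : Y × N →L[ℂ] Z) : Y × N →ₗ[ℂ] Z) : Set (Y × N)) =
      (fun p : Y × N => (p.2 : Z)) ⁻¹'
        (LinearMap.range (S : Y →ₗ[ℂ] Z) ⊓ N : Submodule ℂ Z) := by
    ext ⟨y, z, hz⟩
    have hy : S y ∈ LinearMap.range (S : Y →ₗ[ℂ] Z) := ⟨y, rfl⟩
    simpa [hz] using Submodule.add_mem_iff_right _ hy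
  rw [this]
  exact hinf.preimage (continuous_subtype_val.comp continuous_snd)

/-- If a closed subspace `P` meets the kernel in a finite-dimensional space and has a closed image,
then the closed subspaces of `P` have closed images. -/
theorem isClosed_map_of_le (S : Y →L[ℂ] Z) {P M : Submodule ℂ Y} (hP : IsClosed (P : Set Y))
    (hSP : IsClosed (P.map (S : Y →ₗ[ℂ] Z) : Set Z))
    (hker : FiniteDimensional ℂ (P ⊓ LinearMap.ker (S : Y →ₗ[ℂ] Z) : Submodule ℂ Y))
    (hMP : M ≤ P) (hM : IsClosed (M : Set Y)) : IsClosed (M.map (S : Y →ₗ[ℂ] Z) : Set Z) := by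
  have : CompleteSpace P := hP.completeSpace_coe
  have hr : LinearMap.range ((S ∘L P.subtypeL : P →L[ℂ] Z) : P →ₗ[ℂ] Z) =
      P.map (S : Y →ₗ[ℂ] Z) := by
    rw [ContinuousLinearMap.toLinearMap_comp, LinearMap.range_comp]
    simp
  refine isClosed_of_isClosed_preimage (S ∘L P.subtypeL) (by rwa [hr])
    _ (by rw [hr]; exact Submodule.map_mono hMP) ?_
  -- The preimage of `S(M)` in `P` is `M + (P ∩ ker S)`, a closed space plus a finite-dimensional
  -- one.
  have h := (Submodule.isClosed_sup_finiteDimensional M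
    (P ⊓ LinearMap.ker (S : Y →ₗ[ℂ] Z)) hM).preimage (continuous_subtype_val (p := (· ∈ P)))
  refine (congrArg IsClosed (Set.ext fun y => ?_)).mpr h
  obtain ⟨y, hy⟩ := y
  constructor
  · rintro ⟨m, hm, hmy⟩
    refine Submodule.mem_sup.2 ⟨m, hm, y - m, ⟨sub_mem hy (hMP hm), ?_⟩, by simp⟩
    have : S m = S y := hmy
    simp [this]
  · intro hy'
    obtain ⟨m, hm, k, ⟨-, hk⟩, hmk⟩ := Submodule.mem_sup.1 hy'
    have hk0 : S k = 0 := hk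
    refine ⟨m, hm, ?_⟩
    change S m = S y
    rw [← show m + k = y from hmk, map_add, hk0, add_zero]

/-- An operator range is closed if and only if a subspace containing it with finite codimension
is. -/
theorem isClosed_range_iff_of_finite_ecodim (S : Y →L[ℂ] Z) {P : Submodule ℂ Z}
    (hP : LinearMap.range (S : Y →ₗ[ℂ] Z) ≤ P)
    (hfin : ecodim (LinearMap.range (S : Y →ₗ[ℂ] Z)) P < ⊤) :
    IsClosed (LinearMap.range (S : Y →ₗ[ℂ] Z) : Set Z) ↔ IsClosed (P : Set Z) := by
  rw [ecodim, edim_lt_top_iff] at hfin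
  constructor
  · intro h
    -- `P` is the preimage of a finite-dimensional, hence closed, subspace of the quotient by the
    -- closed range.
    rw [← sup_eq_right.2 hP, ← Submodule.comap_map_mkQ]
    exact (Submodule.closed_of_finiteDimensional
      (P.map (LinearMap.range (S : Y →ₗ[ℂ] Z)).mkQ)).preimage continuous_quot_mk
  · intro h
    obtain ⟨N, hNP, hN, hfinN⟩ : ∃ N : Submodule ℂ Z,
        LinearMap.range (S : Y →ₗ[ℂ] Z) ⊔ N = P ∧
        LinearMap.range (S : Y →ₗ[ℂ] Z) ⊓ N = ⊥ ∧ FiniteDimensional ℂ N := by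
      obtain ⟨C, hC⟩ := Submodule.exists_isCompl (LinearMap.range (S : Y →ₗ[ℂ] Z))
      have hinf : LinearMap.range (S : Y →ₗ[ℂ] Z) ⊓ (C ⊓ P) = ⊥ := by
        rw [← inf_assoc, hC.inf_eq_bot, bot_inf_eq]
      -- By the modular law, a complement of the range cut down to `P` is a complement inside `P`.
      refine ⟨C ⊓ P, ?_, hinf, ?_⟩
      · rw [← sup_inf_assoc_of_le _ hP, hC.sup_eq_top, top_inf_eq]
      · rw [← edim_lt_top_iff, edim_eq_ecodim_add _ (LinearMap.range (S : Y →ₗ[ℂ] Z)),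
          inf_comm (C ⊓ P), hinf]
        have hle : ecodim (LinearMap.range (S : Y →ₗ[ℂ] Z)) (C ⊓ P) < ⊤ :=
          (edim_mono (Submodule.map_mono inf_le_right)).trans_lt (edim_lt_top_iff.2 hfin)
        simpa [edim] using hle
    refine isClosed_range_of_isClosed_sup_inf S N (Submodule.closed_of_finiteDimensional N) ?_ ?_
    · rwa [hNP]
    · rw [hN]; exact isClosed_singleton

end ClosedRange

/-! ### Nullities and defects of the restrictions of `T` and of `T ^ n`. -/

section Operator

variable {X : Type*} [NormedAddCommGroup X] [NormedSpace ℂ X]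

theorem iterRange_coe (T : X →L[ℂ] X) (k : ℕ) : iterRange (T : X →ₗ[ℂ] X) k = rangePow T k := by
  rw [rangePow, ContinuousLinearMap.toLinearMap_pow]; rfl

theorem alpha_restr (T : X →L[ℂ] X) (k : ℕ) : alpha (restr T k) = nul (T : X →ₗ[ℂ] X) k := by
  change edim (LinearMap.ker (restr T k)) = _
  rw [nul, iterRange_coe, ← edim_map_of_injective _ (rangePow T k).injective_subtype]
  congr 1
  ext x
  simp [restr, LinearMap.mem_ker, Subtype.ext_iff, and_comm]

theorem beta_restr (T : X →L[ℂ] X) (k : ℕ) : beta (restr T k) = defect (T : X →ₗ[ℂ] X) k := by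
  rw [beta_eq_ecodim, defect, ← iterRange_map_succ, iterRange_coe]
  congr 1
  rw [← LinearMap.range_comp, restr, LinearMap.subtype_comp_restrict, LinearMap.range_domRestrict]

theorem rangePow_pow (T : X →L[ℂ] X) (n k : ℕ) : rangePow (T ^ n) k = rangePow T (n * k) := by
  rw [rangePow, ← pow_mul, rangePow]

theorem alpha_restr_pow (T : X →L[ℂ] X) (n k : ℕ) :
    alpha (restr (T ^ n) k) = ∑ j ∈ Finset.range n, alpha (restr T (n * k + j)) := by
  simp only [alpha_restr, ← edim_iterRange_inf_ker_pow]
  rw [nul, iterRange_coe, rangePow_pow, iterRange_coe, ContinuousLinearMap.toLinearMap_pow]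

theorem beta_restr_pow (T : X →L[ℂ] X) (n k : ℕ) :
    beta (restr (T ^ n) k) = ∑ j ∈ Finset.range n, beta (restr T (n * k + j)) := by
  simp only [beta_restr, ← ecodim_iterRange]
  simp only [defect, iterRange_coe, rangePow_pow, mul_add, mul_one]

theorem alpha_restr_antitone (T : X →L[ℂ] X) : Antitone fun k => alpha (restr T k) := by
  simpa only [alpha_restr] using nul_antitone (T : X →ₗ[ℂ] X)

theorem beta_restr_antitone (T : X →L[ℂ] X) : Antitone fun k => beta (restr T k) := by
  simpa only [beta_restr] using defect_antitone (T : X →ₗ[ℂ] X)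

theorem sum_shift_lt_top_iff {u : ℕ → ℕ∞} (hu : Antitone u) {n : ℕ} (hn : 0 < n) (k : ℕ) :
    ∑ j ∈ Finset.range n, u (k + j) < ⊤ ↔ u k < ⊤ := by
  rw [ENat.sum_lt_top]
  exact ⟨fun h => h 0 (Finset.mem_range.2 hn), fun h j _ => (hu (Nat.le_add_right k j)).trans_lt h⟩

theorem alpha_restr_pow_lt_top_iff (T : X →L[ℂ] X) {n : ℕ} (hn : 0 < n) (k : ℕ) :
    alpha (restr (T ^ n) k) < ⊤ ↔ alpha (restr T (n * k)) < ⊤ := by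
  rw [alpha_restr_pow]
  exact sum_shift_lt_top_iff (alpha_restr_antitone T) hn _

theorem beta_restr_pow_lt_top_iff (T : X →L[ℂ] X) {n : ℕ} (hn : 0 < n) (k : ℕ) :
    beta (restr (T ^ n) k) < ⊤ ↔ beta (restr T (n * k)) < ⊤ := by
  rw [beta_restr_pow]
  exact sum_shift_lt_top_iff (beta_restr_antitone T) hn _

theorem sInf_natCast_eq_natCast_iff {p : ℕ → Prop} {a : ℕ} :
    sInf {k : ℕ∞ | ∃ n : ℕ, k = n ∧ p n} = a ↔ p a ∧ ∀ b, p b → a ≤ b := by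
  constructor
  · intro h
    have hne : {k : ℕ∞ | ∃ n : ℕ, k = n ∧ p n}.Nonempty := by
      by_contra hc
      rw [Set.not_nonempty_iff_eq_empty] at hc
      rw [hc, sInf_empty] at h
      exact ENat.top_ne_natCast a h
    obtain ⟨n, hn, hp⟩ := csInf_mem hne
    rw [h] at hn
    refine ⟨by rwa [Nat.cast_inj.mp hn], fun b hb => ?_⟩
    have : (a : ℕ∞) ≤ b := h ▸ sInf_le ⟨b, rfl, hb⟩
    exact_mod_cast this
  · rintro ⟨ha, hb⟩
    refine le_antisymm (sInf_le ⟨a, rfl, ha⟩) (le_sInf ?_)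
    rintro _ ⟨b, rfl, hpb⟩
    exact_mod_cast hb b hpb

theorem exists_sInf_natCast_eq {p : ℕ → Prop} {b : ℕ} (hb : p b) :
    ∃ a : ℕ, sInf {k : ℕ∞ | ∃ n : ℕ, k = n ∧ p n} = a ∧ p a ∧ a ≤ b := by
  classical
  refine ⟨Nat.find ⟨b, hb⟩, ?_, Nat.find_spec ⟨b, hb⟩, Nat.find_min' _ hb⟩
  exact sInf_natCast_eq_natCast_iff.2 ⟨Nat.find_spec ⟨b, hb⟩, fun c hc => Nat.find_min' _ hc⟩

/-! ### Closed iterated ranges, and the equivalence for `T` and `T ^ n`. -/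

section Complete

variable [CompleteSpace X] (T : X →L[ℂ] X)

/-- Neubauer's lemma with `N = ker T`: the sum `R(T^k) + ker T` is the preimage of `R(T^(k+1))`
under `T`, and the intersection is finite-dimensional. -/
theorem isClosed_rangePow_of_succ {k : ℕ} (hk : alpha (restr T k) < ⊤)
    (h : IsClosed (rangePow T (k + 1) : Set X)) : IsClosed (rangePow T k : Set X) := by
  rw [alpha_restr, nul, edim_lt_top_iff, iterRange_coe] at hk
  refine isClosed_range_of_isClosed_sup_inf (T ^ k) (LinearMap.ker (T : X →ₗ[ℂ] X))
    T.isClosed_ker ?_ (Submodule.closed_of_finiteDimensional (rangePow T k ⊓ _))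
  change IsClosed ((rangePow T k ⊔ _ : Submodule ℂ X) : Set X)
  rw [← Submodule.comap_map_eq, ← iterRange_coe, iterRange_map_succ, iterRange_coe]
  exact h.preimage T.continuous

theorem isClosed_rangePow_of_le {j k : ℕ} (hjk : j ≤ k) (hj : alpha (restr T j) < ⊤)
    (h : IsClosed (rangePow T k : Set X)) : IsClosed (rangePow T j : Set X) := by
  induction k, hjk using Nat.le_induction with
  | base => exact h
  | succ k hk ih =>
    exact ih (isClosed_rangePow_of_succ T ((alpha_restr_antitone T hk).trans_lt hj) h)

/-- `T` maps the closed space `R(T^j)` onto the closed space `R(T^(j+1))` with finite-dimensional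
kernel, so it sends closed subspaces of `R(T^j)` to closed ones; iterate. -/
theorem isClosed_rangePow_of_ge {j k : ℕ} (hjk : j ≤ k) (hj : alpha (restr T j) < ⊤)
    (h : IsClosed (rangePow T (j + 1) : Set X)) : IsClosed (rangePow T k : Set X) := by
  have hcj := isClosed_rangePow_of_succ T hj h
  rw [alpha_restr, nul, edim_lt_top_iff, iterRange_coe] at hj
  induction k, hjk using Nat.le_induction with
  | base => exact hcj
  | succ k hk ih =>
    rw [← iterRange_coe, ← iterRange_map_succ, iterRange_coe] at h ⊢
    refine isClosed_map_of_le T hcj h hj ?_ ih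
    rw [← iterRange_coe, ← iterRange_coe]
    exact iterRange_antitone _ hk

theorem isClosed_rangePow_iff_of_beta {j k : ℕ} (hjk : j ≤ k) (hj : beta (restr T j) < ⊤) :
    IsClosed (rangePow T k : Set X) ↔ IsClosed (rangePow T j : Set X) := by
  obtain ⟨i, rfl⟩ := Nat.exists_eq_add_of_le hjk
  have hle := iterRange_antitone (T : X →ₗ[ℂ] X) hjk
  have hfin : ecodim (iterRange (T : X →ₗ[ℂ] X) (j + i)) (iterRange (T : X →ₗ[ℂ] X) j) < ⊤ := by
    rw [ecodim_iterRange, ENat.sum_lt_top]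
    intro l _
    rw [beta_restr] at hj
    exact (defect_antitone _ (Nat.le_add_right j l)).trans_lt hj
  rw [iterRange_coe, iterRange_coe] at hle hfin
  exact isClosed_range_iff_of_finite_ecodim (T ^ (j + i)) hle hfin

/-- Frees the definition from the least exponent `a_e(T)`, which need not correspond simply to
`a_e(T^n)`. -/
theorem isUpperSemiBFredholm_iff : IsUpperSemiBFredholm T ↔
    ∃ k, alpha (restr T k) < ⊤ ∧ IsClosed (rangePow T (k + 1) : Set X) := by
  constructor
  · rintro ⟨a, ha, hc⟩
    exact ⟨a, (sInf_natCast_eq_natCast_iff.1 ha).1, hc⟩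
  · rintro ⟨k, hk, hc⟩
    obtain ⟨a, ha, hfin, hle⟩ := exists_sInf_natCast_eq (p := fun k => alpha (restr T k) < ⊤) hk
    exact ⟨a, ha, isClosed_rangePow_of_le T (Nat.succ_le_succ hle)
      ((alpha_restr_antitone T (Nat.le_succ a)).trans_lt hfin) hc⟩

theorem isLowerSemiBFredholm_iff : IsLowerSemiBFredholm T ↔
    ∃ k, beta (restr T k) < ⊤ ∧ IsClosed (rangePow T k : Set X) := by
  constructor
  · rintro ⟨d, hd, hc⟩
    exact ⟨d, (sInf_natCast_eq_natCast_iff.1 hd).1, hc⟩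
  · rintro ⟨k, hk, hc⟩
    obtain ⟨d, hd, hfin, hle⟩ := exists_sInf_natCast_eq (p := fun k => beta (restr T k) < ⊤) hk
    exact ⟨d, hd, (isClosed_rangePow_iff_of_beta T hle hfin).1 hc⟩

theorem isUpperSemiBFredholm_pow_iff {n : ℕ} (hn : 0 < n) :
    IsUpperSemiBFredholm (T ^ n) ↔ IsUpperSemiBFredholm T := by
  simp only [isUpperSemiBFredholm_iff, alpha_restr_pow_lt_top_iff T hn, rangePow_pow]
  constructor
  · rintro ⟨k, hk, hc⟩
    exact ⟨n * k, hk, isClosed_rangePow_of_le T (by rw [mul_add]; lia)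
      ((alpha_restr_antitone T (Nat.le_succ _)).trans_lt hk) hc⟩
  · rintro ⟨k, hk, hc⟩
    have hle : k ≤ n * k := Nat.le_mul_of_pos_left k hn
    exact ⟨k, (alpha_restr_antitone T hle).trans_lt hk,
      isClosed_rangePow_of_ge T (by rw [mul_add]; lia) hk hc⟩

theorem isLowerSemiBFredholm_pow_iff {n : ℕ} (hn : 0 < n) :
    IsLowerSemiBFredholm (T ^ n) ↔ IsLowerSemiBFredholm T := by
  simp only [isLowerSemiBFredholm_iff, beta_restr_pow_lt_top_iff T hn, rangePow_pow]
  constructor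
  · rintro ⟨k, hk, hc⟩
    exact ⟨n * k, hk, hc⟩
  · rintro ⟨k, hk, hc⟩
    have hle : k ≤ n * k := Nat.le_mul_of_pos_left k hn
    exact ⟨k, (beta_restr_antitone T hle).trans_lt hk, (isClosed_rangePow_iff_of_beta T hle hk).2 hc⟩

end Complete

/-! ### The index of a power. -/

section Index

/-- The difference of two extended natural numbers. -/
noncomputable def ediff (a b : ℕ∞) : EReal := ((a : ℝ≥0∞) : EReal) - ((b : ℝ≥0∞) : EReal)

theorem ediff_natCast (a b : ℕ) : ediff a b = (a : EReal) - b := by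
  simp only [ediff, ENat.toENNReal_coe]
  rfl

/-- Finiteness of `c` matters: for `c = ⊤` the left side would be `⊤ - ⊤`, whatever `a` and `b` are.
-/
theorem ediff_add_left (a b : ℕ∞) {c : ℕ∞} (hc : c < ⊤) : ediff (c + a) (c + b) = ediff a b := by
  lift c to ℕ using hc.ne
  induction a with
  | top =>
    induction b with
    | top => simp
    | coe b =>
      rw [add_top, ← Nat.cast_add, ediff, ediff, ENat.toENNReal_top, EReal.coe_ennreal_top,
        EReal.top_sub (by rw [Ne, EReal.coe_ennreal_eq_top_iff]; simp),
        EReal.top_sub (by simp)]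
  | coe a =>
    induction b with
    | top => simp [ediff]
    | coe b =>
      rw [← Nat.cast_add, ← Nat.cast_add, ediff_natCast, ediff_natCast]
      simp only [← EReal.coe_coe_eq_natCast, ← EReal.coe_sub]
      congr 1
      push_cast
      ring

theorem ediff_natCast_mul (n : ℕ) (a b : ℕ∞) : ediff (n * a) (n * b) = n * ediff a b := by
  have hn : ((n : ℝ≥0∞) : EReal) = (n : EReal) := rfl
  simp only [ediff, ENat.toENNReal_mul, EReal.coe_ennreal_mul, ENat.toENNReal_coe, hn]
  exact (EReal.mul_sub_of_nonneg_of_ne_top (by exact_mod_cast Nat.zero_le n)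
    (EReal.natCast_ne_top n)).symm

theorem index_eq (T : X →L[ℂ] X) : index T =
    ediff (alpha (restr T (essDegree T).toNat)) (beta (restr T (essDegree T).toNat)) := rfl

theorem exists_alpha_beta_restr_eq_add (T : X →L[ℂ] X) (m i : ℕ) :
    ∃ c : ℕ∞, alpha (restr T m) = c + alpha (restr T (m + i)) ∧
      beta (restr T m) = c + beta (restr T (m + i)) := by
  simpa only [alpha_restr, beta_restr] using exists_nul_defect_eq_add (T : X →ₗ[ℂ] X) m i

theorem index_pow (T : X →L[ℂ] X) (hT : essDegree T < ⊤)
    (hmin : min (alpha (restr T (essDegree T).toNat)) (beta (restr T (essDegree T).toNat)) < ⊤)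
    {n : ℕ} (hn : 0 < n) : index (T ^ n) = n * index T := by
  obtain ⟨m, hm⟩ := ENat.ne_top_iff_exists.1 hT.ne
  have hp : ∀ k, min (alpha (restr (T ^ n) k)) (beta (restr (T ^ n) k)) < ⊤ ↔
      min (alpha (restr T (n * k))) (beta (restr T (n * k))) < ⊤ := fun k => by
    rw [min_lt_iff, min_lt_iff, alpha_restr_pow_lt_top_iff T hn, beta_restr_pow_lt_top_iff T hn]
  -- `q` is the essential degree of `T ^ n`; it exists because `n * m ≥ m` makes `m` admissible.
  -- Only `m ≤ n * q` is needed below, not equality.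
  obtain ⟨q, hq, hq', -⟩ := exists_sInf_natCast_eq
    (p := fun k => min (alpha (restr (T ^ n) k)) (beta (restr (T ^ n) k)) < ⊤) (b := m) <| by
      rw [hp]
      rw [← hm, ENat.toNat_natCast] at hmin
      have hle : m ≤ n * m := Nat.le_mul_of_pos_left m hn
      exact (min_le_min (alpha_restr_antitone T hle) (beta_restr_antitone T hle)).trans_lt hmin
  have hmq : m ≤ n * q := (sInf_natCast_eq_natCast_iff.1 hm.symm).2 _ ((hp q).1 hq')
  obtain ⟨i, hi⟩ := Nat.exists_eq_add_of_le hmq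
  rw [index_eq, index_eq, show essDegree (T ^ n) = q from hq, ← hm, ENat.toNat_natCast, ENat.toNat_natCast,
    ← ediff_natCast_mul, alpha_restr_pow, beta_restr_pow]
  rw [← hm, ENat.toNat_natCast] at hmin
  choose c hcα hcβ using fun j => exists_alpha_beta_restr_eq_add T m j
  -- Each `c j` is bounded by both the nullity and the defect at `m`, one of which is finite.
  have hfin : ∑ j ∈ Finset.range n, c (i + j) < ⊤ := by
    rw [ENat.sum_lt_top]
    intro j _
    rcases min_lt_iff.1 hmin with h | h
    · exact lt_of_le_of_lt (by rw [hcα (i + j)]; exact le_self_add) h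
    · exact lt_of_le_of_lt (by rw [hcβ (i + j)]; exact le_self_add) h
  -- Adding the total drop to both sums turns every summand into its value at `m`.
  rw [← ediff_add_left _ _ hfin, ← Finset.sum_add_distrib, ← Finset.sum_add_distrib]
  have hα : ∀ j, c (i + j) + alpha (restr T (n * q + j)) = alpha (restr T m) := fun j => by
    rw [hi, add_assoc, ← hcα]
  have hβ : ∀ j, c (i + j) + beta (restr T (n * q + j)) = beta (restr T m) := fun j => by
    rw [hi, add_assoc, ← hcβ]
  simp only [hα, hβ, Finset.sum_const, Finset.card_range, nsmul_eq_mul]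

end Index

end Operator

end SemiBFredholm

theorem mainTheorem10 {X : Type*} [NormedAddCommGroup X] [NormedSpace ℂ X] [CompleteSpace X]
    (T : X →L[ℂ] X) (n : ℕ) (hn : 0 < n) :
    (SemiBFredholm.IsSemiBFredholm T ↔ SemiBFredholm.IsSemiBFredholm (T ^ n)) ∧
      (SemiBFredholm.IsSemiBFredholm T →
        SemiBFredholm.index (T ^ n) = (n : EReal) * SemiBFredholm.index T) := by
  refine ⟨?_, fun h => ?_⟩
  · rw [SemiBFredholm.IsSemiBFredholm, SemiBFredholm.IsSemiBFredholm,
      SemiBFredholm.isUpperSemiBFredholm_pow_iff T hn,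
      SemiBFredholm.isLowerSemiBFredholm_pow_iff T hn]
  · obtain ⟨h1, h2⟩ := h.index_wellDefined
    exact SemiBFredholm.index_pow T h1 h2 hn
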